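/- Let $\mathcal H$ and $\mathcal K$ be complex Hilbert spaces, let $\psi_+,\psi_-\in\mathcal H$ be unit vectors, and let $\rho_+,\rho_-$ be density operators on $\mathcal K$ (positive operators of trace one). A quantum operation from $\mathcal H$ to $\mathcal K$ is a completely positive, trace-non-increasing linear map $\mathcal E$ from the trace-class operators on $\mathcal H$ to those on $\mathcal K$. Its success probabilities are $p_\pm(\mathcal E)=\operatorname{Tr}\mathcal E(|\psi_\pm\rangle\langle\psi_\pm|)$, and it realizes the transformation $\psi_\pm\to\rho_\pm$ if $\mathcal E(|\psi_\pm\rangle\langle\psi_\pm|)=p_\pm(\mathcal E)\,\rho_\pm$ for both signs. Let $F(\rho,\sigma)=\operatorname{Tr}\sqrt{\sqrt{\rho}\,\sigma\sqrt{\rho}}$ be the Uhlmann fidelity. Then the maximum of the mean success probability $\tfrac12 p_+(\mathcal E)+\tfrac12 p_-(\mathcal E)$ over all quantum operations $\mathcal E$ that realize the transformation $\psi_\pm\to\rho_\pm$ exists and equals $$p=\min\left\{\frac{1-|\langle\psi_+|\psi_-\rangle|}{1-F(\rho_+,\rho_-)},\,1\right\},$$ where the right-hand side is read as $1$ if $F(\rho_+,\rho_-)=1$.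 Moreover, this maximum is attained by a balanced transformation, that is, by such an $\mathcal E$ with $p_+(\mathcal E)=p_-(\mathcal E)$. -/

import Mathlib

open scoped ENNReal ComplexOrder

noncomputable section

namespace Quantum

variable {H : Type*} [NormedAddCommGroup H] [InnerProductSpace ℂ H] [CompleteSpace H]
variable {K : Type*} [NormedAddCommGroup K] [InnerProductSpace ℂ K] [CompleteSpace K]

variable (H) in
/-- The vectors of some orthonormal basis of the Hilbert space `H`. -/
def basisSet : Set H := (exists_hilbertBasis ℂ H).choose

variable (H) in
/-- An orthonormal basis of the Hilbert space `H`. -/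
def basis : HilbertBasis (basisSet H) ℂ H := (exists_hilbertBasis ℂ H).choose_spec.choose

/-- The trace of a positive operator: the sum of its diagonal entries in an orthonormal basis, with
values in `[0, ∞]`. For positive operators (the only ones it is used for) the value does not depend
on the basis. -/
def posTrace (T : H →L[ℂ] H) : ℝ≥0∞ :=
  ∑' i, ENNReal.ofReal (inner ℂ (basis H i) (T (basis H i))).re

variable (H) in
/-- The trace-class operators on `H`: the linear combinations of positive operators of finite
trace. -/
def traceClass : Submodule ℂ (H →L[ℂ] H) :=
  Submodule.span ℂ {T | T.IsPositive ∧ posTrace T < ∞}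

/-- A density operator: a positive operator of trace one. -/
def IsDensity (ρ : H →L[ℂ] H) : Prop :=
  ρ.IsPositive ∧ posTrace ρ = 1

lemma posTrace_rankOne_lt_top (ψ : H) : posTrace (InnerProductSpace.rankOne ℂ ψ ψ) < ∞ := by
  have hs : Summable fun i =>
      (inner ℂ (basis H i) (InnerProductSpace.rankOne ℂ ψ ψ (basis H i))).re := by
    have h := Complex.reCLM.summable ((basis H).summable_inner_mul_inner ψ ψ)
    refine h.congr fun i => ?_
    simp [InnerProductSpace.rankOne_apply]
  exact hs.tsum_ofReal_lt_top

/-- The operator `|ψ⟩⟨ψ|`, as a trace-class operator. -/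
def ketbra (ψ : H) : traceClass H :=
  ⟨InnerProductSpace.rankOne ℂ ψ ψ, Submodule.subset_span
    ⟨InnerProductSpace.isPositive_rankOne_self ψ, posTrace_rankOne_lt_top ψ⟩⟩

/-- Positivity of the operator on `H ⊕ ⋯ ⊕ H` (`n` summands) with blocks `A i j`. -/
def BlockPositive {n : ℕ} (A : Fin n → Fin n → H →L[ℂ] H) : Prop :=
  ∀ x : Fin n → H, 0 ≤ ∑ i, ∑ j, inner ℂ (x i) (A i j (x j))

variable (H K) in
/-- A quantum operation from `H` to `K`: a completely positive, trace-non-increasing linear map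
from the trace-class operators on `H` to those on `K`. -/
structure QuantumOperation where
  /-- The underlying linear map. -/
  map : traceClass H →ₗ[ℂ] traceClass K
  /-- Complete positivity. -/
  completely_positive : ∀ (n : ℕ) (T : Fin n → Fin n → traceClass H),
    BlockPositive (fun i j => (T i j : H →L[ℂ] H)) →
      BlockPositive (fun i j => (map (T i j) : K →L[ℂ] K))
  /-- The trace of a positive operator does not increase. -/
  trace_le : ∀ T : traceClass H, (T : H →L[ℂ] H).IsPositive →
    posTrace (map T : K →L[ℂ] K) ≤ posTrace (T : H →L[ℂ] H)

/-- The probability `Tr E(|ψ⟩⟨ψ|)` that the quantum operation `E` occurs on the pure state `ψ`. -/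
def QuantumOperation.prob (E : QuantumOperation H K) (ψ : H) : ℝ :=
  (posTrace (E.map (ketbra ψ) : K →L[ℂ] K)).toReal

/-- `E` sends the pure state `ψ` to the state `ρ`, with its probability of success:
`E(|ψ⟩⟨ψ|) = p ρ` where `p = Tr E(|ψ⟩⟨ψ|)`. -/
def QuantumOperation.Sends (E : QuantumOperation H K) (ψ : H) (ρ : K →L[ℂ] K) : Prop :=
  (E.map (ketbra ψ) : K →L[ℂ] K) = (E.prob ψ : ℂ) • ρ

/-- The Uhlmann fidelity `Tr √(√ρ σ √ρ)` of two density operators. -/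
def fidelity (ρ σ : K →L[ℂ] K) : ℝ :=
  (posTrace (CFC.sqrt (CFC.sqrt ρ * σ * CFC.sqrt ρ))).toReal

/-- The number `min {(1 - |⟨ψ₁|ψ₂⟩|) / (1 - F(ρ₁, ρ₂)), 1}`, which is `1` if the denominator
vanishes. -/
def optimalProb (ψ₁ ψ₂ : H) (ρ₁ ρ₂ : K →L[ℂ] K) : ℝ :=
  open Classical in
  if fidelity ρ₁ ρ₂ = 1 then 1
  else min ((1 - ‖inner ℂ ψ₁ ψ₂‖) / (1 - fidelity ρ₁ ρ₂)) 1

end Quantum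

end

/-!
The upper bound comes from the operator `E(|ψ₁ - ψ₂⟩⟨ψ₁ - ψ₂|)`, after a phase has been chosen that
makes the overlap `s = ⟨ψ₁, ψ₂⟩` real and nonnegative (`Quantum.exists_ketbra_eq_of_overlap`). Its
trace is at most `‖ψ₁ - ψ₂‖² = 2 - 2 s`, and it equals `p₁ + p₂ - 2 Re Tr X` with
`X = E(|ψ₁⟩⟨ψ₂|)`. Complete positivity makes the block operator with diagonal `p₁ ρ₁`, `p₂ ρ₂` and
off-diagonal `X`, `X†` positive, so that `X = √(p₁ p₂) √ρ₁ C √ρ₂` for a contraction `C`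
(`Quantum.exists_eq_adjoint_mul_mul`), and
`|Tr X| ≤ √(p₁ p₂) F(ρ₁, ρ₂) ≤ (p₁ + p₂) / 2 * F(ρ₁, ρ₂)`.
Hence `(p₁ + p₂) / 2 * (1 - F(ρ₁, ρ₂)) ≤ 1 - s` (`Quantum.QuantumOperation.mean_prob_mul_le`).

The fidelity enters through its variational description: `F(ρ, σ)` is the maximum of
`|Tr (√ρ C √σ)|` over contractions `C` (`Quantum.exists_hsInner_eq_fidelity` and
`Quantum.norm_hsInner_le_fidelity`). It is proved with Hilbert–Schmidt inner products, whose
invariance under adjoints replaces the cyclicity of the trace, and with Douglas' factorization lemma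
in place of the polar decomposition.

For the converse, suppose `s < 1` and let `t = min s F(ρ₁, ρ₂)`, written as `t = Tr (√ρ₁ C √ρ₂)`.
With `φ₁, φ₂` dual to `ψ₁, ψ₂` in their span, the map `T ↦ p ∑ i j, ⟨φᵢ, T φⱼ⟩ Yᵢⱼ`, where `Y` has
diagonal blocks `ρ₁`, `ρ₂` and off-diagonal blocks `√ρ₁ C √ρ₂` and its adjoint, sends `ψᵢ` to `ρᵢ`
with probability `p`. It is completely positive by the Schur product theorem
(`Quantum.blockPositive_schurMap`). The trace of the image is diagonal along `ψ₁ + ψ₂` and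
`ψ₁ - ψ₂`, and does not increase exactly when `p (1 + t) ≤ 1 + s` and `p (1 - t) ≤ 1 - s`
(`Quantum.exists_operation_of_overlap`); the optimal `p` satisfies both. If `s = 1`, the two states
coincide; then either `p = 0`, or the fidelity is `1` and `ρ₁ = ρ₂`
(`Quantum.eq_of_fidelity_eq_one`).
-/

noncomputable section

namespace Quantum

open scoped InnerProduct

variable {H : Type*} [NormedAddCommGroup H] [InnerProductSpace ℂ H] [CompleteSpace H]
variable {K : Type*} [NormedAddCommGroup K] [InnerProductSpace ℂ K] [CompleteSpace K]

/-! ### Hilbert–Schmidt operators -/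

/-- The square of the Hilbert–Schmidt norm of `S`, computed in the chosen orthonormal basis. -/
def hsNormSq (S : H →L[ℂ] H) : ℝ≥0∞ :=
  ∑' i, ENNReal.ofReal (‖S (basis H i)‖ ^ 2)

/-- `S` is a Hilbert–Schmidt operator. -/
def IsHS (S : H →L[ℂ] H) : Prop :=
  Summable fun i => ‖S (basis H i)‖ ^ 2

/-- The Hilbert–Schmidt inner product `Tr (S† T)`; it is meaningful when `S` and `T` are
Hilbert–Schmidt operators. -/
def hsInner (S T : H →L[ℂ] H) : ℂ :=
  ∑' i, inner ℂ (S (basis H i)) (T (basis H i))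

lemma hasSum_norm_sq_inner_basis (x : H) :
    HasSum (fun i => ‖inner ℂ (basis H i) x‖ ^ 2) (‖x‖ ^ 2) := by
  have h := Complex.reCLM.hasSum ((basis H).hasSum_inner_mul_inner x x)
  convert h using 1
  · funext i
    rw [← inner_conj_symm x, Complex.reCLM_apply, mul_comm, Complex.mul_conj,
      Complex.ofReal_re, Complex.normSq_eq_norm_sq]
  · simp [inner_self_eq_norm_sq_to_K, ← Complex.ofReal_pow]

lemma tsum_ofReal_norm_sq_inner_basis (x : H) :
    ∑' i, ENNReal.ofReal (‖inner ℂ (basis H i) x‖ ^ 2) = ENNReal.ofReal (‖x‖ ^ 2) := by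
  rw [← (hasSum_norm_sq_inner_basis x).tsum_eq,
    ENNReal.ofReal_tsum_of_nonneg (fun _ => by positivity) (hasSum_norm_sq_inner_basis x).summable]

/-- An operator and its adjoint have the same Hilbert–Schmidt norm. This is what makes traces
cyclic and independent of the basis. -/
lemma hsNormSq_adjoint (S : H →L[ℂ] H) : hsNormSq (S†) = hsNormSq S := by
  have h (R : H →L[ℂ] H) : hsNormSq R =
      ∑' i, ∑' j, ENNReal.ofReal (‖inner ℂ (basis H j) (R (basis H i))‖ ^ 2) :=
    tsum_congr fun i => (tsum_ofReal_norm_sq_inner_basis _).symm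
  rw [h, h, ENNReal.tsum_comm]
  refine tsum_congr fun i => tsum_congr fun j => ?_
  rw [ContinuousLinearMap.adjoint_inner_right, ← inner_conj_symm, RCLike.norm_conj]

lemma isHS_iff {S : H →L[ℂ] H} : IsHS S ↔ hsNormSq S < ∞ := by
  refine ⟨fun h => h.tsum_ofReal_lt_top, fun h => ?_⟩
  refine (ENNReal.summable_toReal h.ne).congr fun i => ?_
  rw [ENNReal.toReal_ofReal (by positivity)]

lemma IsHS.hsNormSq_eq {S : H →L[ℂ] H} (h : IsHS S) :
    hsNormSq S = ENNReal.ofReal (∑' i, ‖S (basis H i)‖ ^ 2) :=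
  (ENNReal.ofReal_tsum_of_nonneg (fun _ => by positivity) h).symm

lemma IsHS.tsum_eq {S : H →L[ℂ] H} (h : IsHS S) :
    ∑' i, ‖S (basis H i)‖ ^ 2 = (hsNormSq S).toReal := by
  rw [h.hsNormSq_eq, ENNReal.toReal_ofReal (tsum_nonneg fun _ => by positivity)]

lemma IsHS.adjoint {S : H →L[ℂ] H} (h : IsHS S) : IsHS (S†) := by
  rw [isHS_iff, hsNormSq_adjoint]; exact isHS_iff.1 h

lemma norm_apply_le_of_norm_le_one {E : Type*} [NormedAddCommGroup E] [InnerProductSpace ℂ E]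
    {D : E →L[ℂ] E} (hD : ‖D‖ ≤ 1) (x : E) : ‖D x‖ ≤ ‖x‖ :=
  (D.le_of_opNorm_le hD x).trans (one_mul _).le

lemma hsNormSq_mul_le {D : H →L[ℂ] H} (hD : ‖D‖ ≤ 1) (S : H →L[ℂ] H) :
    hsNormSq (D * S) ≤ hsNormSq S := by
  refine ENNReal.tsum_le_tsum fun i => ENNReal.ofReal_le_ofReal ?_
  gcongr
  exact norm_apply_le_of_norm_le_one hD _

lemma adjoint_mul (S T : H →L[ℂ] H) : (S * T)† = T† * S† :=
  ContinuousLinearMap.adjoint_comp S T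

lemma norm_adjoint_le_one {D : H →L[ℂ] H} (hD : ‖D‖ ≤ 1) : ‖D†‖ ≤ 1 := by
  rwa [LinearIsometryEquiv.norm_map]

lemma hsNormSq_mul_le' {D : H →L[ℂ] H} (hD : ‖D‖ ≤ 1) (S : H →L[ℂ] H) :
    hsNormSq (S * D) ≤ hsNormSq S := by
  rw [← hsNormSq_adjoint, adjoint_mul, ← hsNormSq_adjoint S]
  exact hsNormSq_mul_le (norm_adjoint_le_one hD) _

lemma IsHS.mul_left {S : H →L[ℂ] H} (h : IsHS S) {D : H →L[ℂ] H} (hD : ‖D‖ ≤ 1) : IsHS (D * S) :=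
  isHS_iff.2 ((hsNormSq_mul_le hD S).trans_lt (isHS_iff.1 h))

lemma IsHS.mul_right {S : H →L[ℂ] H} (h : IsHS S) {D : H →L[ℂ] H} (hD : ‖D‖ ≤ 1) : IsHS (S * D) :=
  isHS_iff.2 ((hsNormSq_mul_le' hD S).trans_lt (isHS_iff.1 h))

lemma norm_add_sq_le {E : Type*} [NormedAddCommGroup E] [InnerProductSpace ℂ E] (x y : E) :
    ‖x + y‖ ^ 2 ≤ 2 * ‖x‖ ^ 2 + 2 * ‖y‖ ^ 2 := by
  nlinarith [parallelogram_law_with_norm ℂ x y, norm_nonneg (x - y)]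

lemma IsHS.add {S T : H →L[ℂ] H} (hS : IsHS S) (hT : IsHS T) : IsHS (S + T) :=
  Summable.of_nonneg_of_le (fun _ => by positivity) (fun _ => norm_add_sq_le _ _)
    ((Summable.mul_left 2 hS).add (Summable.mul_left 2 hT))

lemma IsHS.smul {S : H →L[ℂ] H} (hS : IsHS S) (c : ℂ) : IsHS (c • S) := by
  refine (Summable.mul_left (‖c‖ ^ 2) hS).congr fun i => ?_
  rw [smul_apply, norm_smul, mul_pow]

lemma IsHS.sub {S T : H →L[ℂ] H} (hS : IsHS S) (hT : IsHS T) : IsHS (S - T) := by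
  simpa [sub_eq_add_neg] using hS.add (hT.smul (-1))

lemma norm_inner_le_half {E : Type*} [NormedAddCommGroup E] [InnerProductSpace ℂ E] (x y : E) :
    ‖inner ℂ x y‖ ≤ (‖x‖ ^ 2 + ‖y‖ ^ 2) / 2 := by
  nlinarith [norm_inner_le_norm (𝕜 := ℂ) x y, sq_nonneg (‖x‖ - ‖y‖)]

lemma IsHS.hasSum_hsInner {S T : H →L[ℂ] H} (hS : IsHS S) (hT : IsHS T) :
    HasSum (fun i => inner ℂ (S (basis H i)) (T (basis H i))) (hsInner S T) :=
  (Summable.of_norm_bounded ((Summable.add hS hT).div_const 2)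
    fun _ => norm_inner_le_half _ _).hasSum

lemma IsHS.norm_hsInner_le {S T : H →L[ℂ] H} (hS : IsHS S) (hT : IsHS T) :
    ‖hsInner S T‖ ≤ ((hsNormSq S).toReal + (hsNormSq T).toReal) / 2 := by
  rw [← hS.tsum_eq, ← hT.tsum_eq, ← Summable.tsum_add hS hT, ← tsum_div_const]
  exact tsum_of_norm_bounded ((Summable.add hS hT).div_const 2).hasSum
    fun _ => norm_inner_le_half _ _

/-- The Hilbert–Schmidt inner product by polarization. -/
lemma IsHS.hsInner_eq {S T : H →L[ℂ] H} (hS : IsHS S) (hT : IsHS T) :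
    hsInner S T = (((hsNormSq (S + T)).toReal - (hsNormSq (S - T)).toReal : ℝ) +
      ((hsNormSq (S - Complex.I • T)).toReal - (hsNormSq (S + Complex.I • T)).toReal : ℝ)
        * Complex.I) / 4 := by
  have h1 := hS.add hT
  have h2 := hS.sub hT
  have h3 := hS.sub (hT.smul Complex.I)
  have h4 := hS.add (hT.smul Complex.I)
  rw [← h1.tsum_eq, ← h2.tsum_eq, ← h3.tsum_eq, ← h4.tsum_eq]
  have e1 := Complex.hasSum_ofReal.2 ((Summable.hasSum h1).sub (Summable.hasSum h2))
  have e2 := Complex.hasSum_ofReal.2 ((Summable.hasSum h3).sub (Summable.hasSum h4))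
  refine HasSum.tsum_eq ?_
  refine ((e1.add (e2.mul_right Complex.I)).div_const 4).congr_fun fun i => ?_
  rw [inner_eq_sum_norm_sq_div_four]
  simp

lemma hsNormSq_smul (c : ℂ) (hc : ‖c‖ = 1) (S : H →L[ℂ] H) : hsNormSq (c • S) = hsNormSq S := by
  refine tsum_congr fun i => ?_
  rw [smul_apply, norm_smul, hc, one_mul]

/-- Cyclicity of the trace: `Tr (S† T) = Tr (T S†)`. -/
lemma IsHS.hsInner_adjoint {S T : H →L[ℂ] H} (hS : IsHS S) (hT : IsHS T) :
    hsInner (T†) (S†) = hsInner S T := by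
  rw [hS.hsInner_eq hT, hT.adjoint.hsInner_eq hS.adjoint]
  have e1 : hsNormSq (T† + S†) = hsNormSq (S + T) := by
    rw [← hsNormSq_adjoint, map_add]; simp [add_comm]
  have e2 : hsNormSq (T† - S†) = hsNormSq (S - T) := by
    rw [← hsNormSq_adjoint, map_sub, ← hsNormSq_smul (-1) (by simp)]; simp
  have e3 : hsNormSq (T† - Complex.I • S†) = hsNormSq (S - Complex.I • T) := by
    rw [← hsNormSq_adjoint, map_sub, ← hsNormSq_smul (-Complex.I) (by simp)]
    simp only [map_smulₛₗ, ContinuousLinearMap.adjoint_adjoint, smul_sub, smul_smul]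
    congr 1
    simp [sub_eq_add_neg, add_comm]
  have e4 : hsNormSq (T† + Complex.I • S†) = hsNormSq (S + Complex.I • T) := by
    rw [← hsNormSq_adjoint, map_add, ← hsNormSq_smul Complex.I (by simp)]
    simp only [map_smulₛₗ, ContinuousLinearMap.adjoint_adjoint, smul_add, smul_smul]
    congr 1
    simp [add_comm]
  rw [e1, e2, e3, e4]

/-! ### Traces and square roots -/

/-- The diagonal entries of `T` in the chosen orthonormal basis sum to `τ`. -/
def HasTrace (T : H →L[ℂ] H) (τ : ℂ) : Prop :=
  HasSum (fun i => inner ℂ (basis H i) (T (basis H i))) τ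

lemma HasTrace.add {S T : H →L[ℂ] H} {σ τ : ℂ} (hS : HasTrace S σ) (hT : HasTrace T τ) :
    HasTrace (S + T) (σ + τ) :=
  (HasSum.add hS hT).congr_fun fun i => by simp

lemma HasTrace.smul {T : H →L[ℂ] H} {τ : ℂ} (hT : HasTrace T τ) (c : ℂ) :
    HasTrace (c • T) (c * τ) :=
  (HasSum.mul_left c hT).congr_fun fun i => by simp

lemma HasTrace.posTrace_eq {T : H →L[ℂ] H} {τ : ℂ} (hT : HasTrace T τ) (hp : T.IsPositive) :
    posTrace T = ENNReal.ofReal τ.re := by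
  have h := Complex.reCLM.hasSum hT
  rw [← Complex.reCLM_apply, ← h.tsum_eq]
  exact (ENNReal.ofReal_tsum_of_nonneg (fun i => hp.re_inner_nonneg_right _) h.summable).symm

lemma hasTrace_adjoint_mul {S T : H →L[ℂ] H} (hS : IsHS S) (hT : IsHS T) :
    HasTrace (S† * T) (hsInner S T) :=
  (hS.hasSum_hsInner hT).congr_fun fun i => by
    rw [mul_apply_eq_comp, ContinuousLinearMap.adjoint_inner_right]

lemma posTrace_adjoint_mul_self (S : H →L[ℂ] H) : posTrace (S† * S) = hsNormSq S := by
  refine tsum_congr fun i => ?_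
  rw [mul_apply_eq_comp, ContinuousLinearMap.adjoint_inner_right,
    inner_self_eq_norm_sq_to_K]
  norm_cast

lemma hsInner_self (S : H →L[ℂ] H) (hS : IsHS S) : hsInner S S = (hsNormSq S).toReal := by
  rw [← hS.tsum_eq, Complex.ofReal_tsum]
  refine tsum_congr fun i => ?_
  rw [inner_self_eq_norm_sq_to_K]
  norm_cast

lemma adjoint_sqrt (ρ : H →L[ℂ] H) : (CFC.sqrt ρ)† = CFC.sqrt ρ :=
  (CFC.sqrt_nonneg ρ).isSelfAdjoint

lemma sqrt_mul_sqrt {ρ : H →L[ℂ] H} (hρ : ρ.IsPositive) : CFC.sqrt ρ * CFC.sqrt ρ = ρ :=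
  CFC.sqrt_mul_sqrt_self ρ ((ContinuousLinearMap.nonneg_iff_isPositive ρ).2 hρ)

lemma posTrace_eq_hsNormSq_sqrt {ρ : H →L[ℂ] H} (hρ : ρ.IsPositive) :
    posTrace ρ = hsNormSq (CFC.sqrt ρ) := by
  rw [← posTrace_adjoint_mul_self, adjoint_sqrt, sqrt_mul_sqrt hρ]

lemma inner_sqrt_apply_sqrt {ρ : H →L[ℂ] H} (hρ : ρ.IsPositive) (x y : H) :
    inner ℂ (CFC.sqrt ρ x) (CFC.sqrt ρ y) = inner ℂ x (ρ y) := by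
  rw [← ContinuousLinearMap.adjoint_inner_right, adjoint_sqrt, ← mul_apply_eq_comp,
    sqrt_mul_sqrt hρ]

lemma hasTrace_of_isPositive {ρ : H →L[ℂ] H} (hρ : ρ.IsPositive) (h : posTrace ρ < ∞) :
    HasTrace ρ (posTrace ρ).toReal := by
  have hs : IsHS (CFC.sqrt ρ) := by rwa [isHS_iff, ← posTrace_eq_hsNormSq_sqrt hρ]
  have := hasTrace_adjoint_mul hs hs
  rwa [hsInner_self _ hs, ← posTrace_eq_hsNormSq_sqrt hρ, adjoint_sqrt, sqrt_mul_sqrt hρ] at this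

lemma IsDensity.hasTrace {ρ : H →L[ℂ] H} (h : IsDensity ρ) : HasTrace ρ 1 := by
  simpa [h.2] using hasTrace_of_isPositive h.1 (by simp [h.2])

lemma IsDensity.hsNormSq_sqrt {ρ : H →L[ℂ] H} (h : IsDensity ρ) : hsNormSq (CFC.sqrt ρ) = 1 := by
  rw [← posTrace_eq_hsNormSq_sqrt h.1, h.2]

lemma IsDensity.isHS_sqrt {ρ : H →L[ℂ] H} (h : IsDensity ρ) : IsHS (CFC.sqrt ρ) := by
  simp [isHS_iff, h.hsNormSq_sqrt]

/-- The product of two Hilbert–Schmidt operators is of trace class, by polarization. -/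
lemma adjoint_mul_mem_traceClass {S T : H →L[ℂ] H} (hS : IsHS S) (hT : IsHS T) :
    S† * T ∈ traceClass H := by
  have key {R : H →L[ℂ] H} (hR : IsHS R) : R† * R ∈ traceClass H :=
    Submodule.subset_span ⟨ContinuousLinearMap.isPositive_adjoint_comp_self R, by
      rw [posTrace_adjoint_mul_self]; exact isHS_iff.1 hR⟩
  have e : S† * T = (1 / 4 : ℂ) • ((S + T)† * (S + T)) - (1 / 4 : ℂ) • ((S - T)† * (S - T)) +
      ((Complex.I / 4) • ((S - Complex.I • T)† * (S - Complex.I • T)) -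
        (Complex.I / 4) • ((S + Complex.I • T)† * (S + Complex.I • T))) := by
    simp only [map_add, map_sub, map_smulₛₗ, add_mul, mul_add, sub_mul, mul_sub, smul_mul_assoc,
      mul_smul_comm, smul_add, smul_sub, smul_smul, Complex.conj_I]
    have h1 : Complex.I / 4 * Complex.I = -1 / 4 := by
      rw [div_mul_eq_mul_div, Complex.I_mul_I]
    have h2 : Complex.I / 4 * -Complex.I = 1 / 4 := by
      rw [mul_neg, h1]; norm_num
    simp only [h1, h2]
    module
  rw [e]
  have hI := hT.smul Complex.I
  exact (traceClass H).add_mem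
    ((traceClass H).sub_mem ((traceClass H).smul_mem _ (key (hS.add hT)))
      ((traceClass H).smul_mem _ (key (hS.sub hT))))
    ((traceClass H).sub_mem ((traceClass H).smul_mem _ (key (hS.sub hI)))
      ((traceClass H).smul_mem _ (key (hS.add hI))))

/-! ### Factorization of operators -/

/-- Douglas' lemma: if `‖S x‖ ≤ ‖T x‖` for all `x` then `S` factors through `T` by a contraction,
which may be chosen to vanish on the orthogonal complement of the range of `T`. -/
lemma exists_mul_eq_of_norm_le {S T : H →L[ℂ] H} (h : ∀ x, ‖S x‖ ≤ ‖T x‖) :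
    ∃ D : H →L[ℂ] H, ‖D‖ ≤ 1 ∧ D * T = S ∧
      D * T.range.topologicalClosure.starProjection = D := by
  set U := T.range.topologicalClosure
  have hmem (x : H) : T x ∈ U := T.range.le_topologicalClosure ⟨x, rfl⟩
  have : CompleteSpace U := T.range.isClosed_topologicalClosure.completeSpace_coe
  let e : H →ₗ[ℂ] U := T.toLinearMap.codRestrict U hmem
  have he : DenseRange e := by
    rw [DenseRange, dense_iff_closure_eq, Set.eq_univ_iff_forall]
    rintro ⟨y, hy⟩
    rw [closure_subtype]
    have : ((↑) '' Set.range e : Set H) = T.range := by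
      ext z; simp [e]
    rw [this]
    exact hy
  have hn : ∀ x, ‖S.toLinearMap x‖ ≤ 1 * ‖e x‖ := fun x => by simpa [e] using h x
  let D₀ : U →L[ℂ] H := S.toLinearMap.extendOfNorm e
  refine ⟨D₀ ∘L U.orthogonalProjectionOnto, ?_, ?_, ?_⟩
  · refine ContinuousLinearMap.opNorm_le_bound _ zero_le_one fun x => ?_
    refine (LinearMap.norm_extendOfNorm_apply_le he 1 hn _).trans ?_
    gcongr
    exact U.norm_orthogonalProjectionOnto_apply_le x
  · ext x
    have : U.orthogonalProjectionOnto (T x) = e x :=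
      Submodule.orthogonalProjectionOnto_mem_subspace_eq_self (⟨T x, hmem x⟩ : U)
    rw [mul_apply_eq_comp, ContinuousLinearMap.comp_apply, this]
    exact LinearMap.extendOfNorm_eq he ⟨1, hn⟩ x
  · ext x
    exact congrArg D₀
      (Submodule.orthogonalProjectionOnto_mem_subspace_eq_self (U.orthogonalProjectionOnto x))

/-- If the form `⟨x, X y⟩` is dominated by `‖A x‖ ‖B y‖`, then `X = A† C B` for a contraction
`C`. -/
lemma exists_eq_adjoint_mul_mul {X A B : H →L[ℂ] H}
    (h : ∀ x y, ‖inner ℂ x (X y)‖ ≤ ‖A x‖ * ‖B y‖) :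
    ∃ C : H →L[ℂ] H, ‖C‖ ≤ 1 ∧ X = A† * (C * B) := by
  -- Rescaling `A` by `b` makes Douglas' lemma applicable to `X†`; adding `1` keeps `b` nonzero.
  have hb : (0 : ℝ) < ‖B‖ + 1 := by positivity
  set b : ℝ := ‖B‖ + 1
  have hX x : ‖(X†) x‖ ≤ ‖((b : ℂ) • A) x‖ := by
    rw [smul_apply, norm_smul, Complex.norm_of_nonneg hb.le]
    have h1 : ‖(X†) x‖ * ‖(X†) x‖ ≤ ‖A x‖ * (‖B‖ * ‖(X†) x‖) := by
      have h2 : ‖(X†) x‖ * ‖(X†) x‖ = ‖inner ℂ x (X ((X†) x))‖ := by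
        rw [← ContinuousLinearMap.adjoint_inner_left, inner_self_eq_norm_sq_to_K, norm_pow,
          RCLike.norm_ofReal, abs_norm, sq]
      rw [h2]
      refine (h _ _).trans ?_
      gcongr
      exact B.le_opNorm _
    rcases (norm_nonneg ((X†) x)).eq_or_lt with h0 | h0
    · rw [← h0]; positivity
    · nlinarith [norm_nonneg (A x)]
  obtain ⟨D, -, hD, hDP⟩ := exists_mul_eq_of_norm_le hX
  set U := ((b : ℂ) • A).range.topologicalClosure
  have hmem y : (D†) y ∈ U := by
    rw [← hDP, adjoint_mul, mul_apply_eq_comp, (isSelfAdjoint_starProjection U).adjoint_eq]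
    exact U.starProjection_apply_mem _
  -- The bound on the form passes from the range of `A` to its closure, which contains `D† y`.
  have hbound y : ∀ z ∈ U, ‖inner ℂ z ((D†) y)‖ ≤ ‖z‖ * (b⁻¹ * ‖B y‖) := by
    intro z hz
    refine closure_minimal (s := (((b : ℂ) • A).range : Set H))
      (t := {z | ‖inner ℂ z ((D†) y)‖ ≤ ‖z‖ * (b⁻¹ * ‖B y‖)}) ?_
      (isClosed_le (by fun_prop) (by fun_prop)) hz
    rintro _ ⟨x, rfl⟩
    have h1 : inner ℂ (((b : ℂ) • A) x) ((D†) y) = inner ℂ x (X y) := by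
      rw [ContinuousLinearMap.adjoint_inner_right, ← mul_apply_eq_comp, hD,
        ContinuousLinearMap.adjoint_inner_left]
    have h2 : ‖((b : ℂ) • A) x‖ = b * ‖A x‖ := by
      rw [smul_apply, norm_smul, Complex.norm_of_nonneg hb.le]
    change ‖inner ℂ (((b : ℂ) • A) x) ((D†) y)‖ ≤ ‖((b : ℂ) • A) x‖ * (b⁻¹ * ‖B y‖)
    rw [h1, h2]
    refine (h x y).trans_eq ?_
    field_simp
  have hDB y : ‖(D†) y‖ ≤ ‖((b : ℂ)⁻¹ • B) y‖ := by
    rw [smul_apply, norm_smul, norm_inv, Complex.norm_of_nonneg hb.le]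
    have := hbound y _ (hmem y)
    rw [inner_self_eq_norm_sq_to_K, norm_pow, RCLike.norm_ofReal, abs_norm, sq] at this
    rcases (norm_nonneg ((D†) y)).eq_or_lt with h0 | h0
    · rw [← h0]; positivity
    · exact le_of_mul_le_mul_left this h0
  obtain ⟨C, hC, hCB, -⟩ := exists_mul_eq_of_norm_le hDB
  refine ⟨C, hC, ?_⟩
  have hb' : (b : ℂ) ≠ 0 := by exact_mod_cast hb.ne'
  rw [← ContinuousLinearMap.adjoint_adjoint X, ← hD, adjoint_mul, ← hCB, map_smulₛₗ,
    Complex.conj_ofReal, mul_smul_comm, smul_mul_assoc, mul_smul_comm, smul_smul,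
    mul_inv_cancel₀ hb', one_smul]

/-! ### Uhlmann fidelity -/

lemma isPositive_sqrt_mul_mul_sqrt (ρ : K →L[ℂ] K) {σ : K →L[ℂ] K} (hσ : σ.IsPositive) :
    (CFC.sqrt ρ * σ * CFC.sqrt ρ).IsPositive := by
  have h := hσ.conj_adjoint (CFC.sqrt ρ)
  rwa [adjoint_sqrt, ← ContinuousLinearMap.comp_assoc] at h

lemma isPositive_sqrt (ρ : K →L[ℂ] K) : (CFC.sqrt ρ).IsPositive :=
  (ContinuousLinearMap.nonneg_iff_isPositive _).1 (CFC.sqrt_nonneg ρ)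

/-- The operator `√(√ρ σ √ρ)` is the absolute value of `√σ √ρ`. -/
lemma norm_sqrt_sqrt_mul_mul_sqrt_apply (ρ : K →L[ℂ] K) {σ : K →L[ℂ] K} (hσ : σ.IsPositive)
    (x : K) :
    ‖CFC.sqrt (CFC.sqrt ρ * σ * CFC.sqrt ρ) x‖ = ‖(CFC.sqrt σ * CFC.sqrt ρ) x‖ := by
  have h1 := inner_sqrt_apply_sqrt (isPositive_sqrt_mul_mul_sqrt ρ hσ) x x
  have h2 : inner ℂ ((CFC.sqrt σ * CFC.sqrt ρ) x) ((CFC.sqrt σ * CFC.sqrt ρ) x) =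
      inner ℂ x ((CFC.sqrt ρ * σ * CFC.sqrt ρ) x) := by
    rw [mul_apply_eq_comp, inner_sqrt_apply_sqrt hσ, ← ContinuousLinearMap.adjoint_inner_right,
      adjoint_sqrt]
    rfl
  rw [← h2, inner_self_eq_norm_sq_to_K, inner_self_eq_norm_sq_to_K] at h1
  exact (sq_eq_sq₀ (norm_nonneg _) (norm_nonneg _)).1 (by exact_mod_cast h1)

/-- The fidelity is attained: `F(ρ, σ) = Tr (√ρ C √σ)` for some contraction `C`. The same
computation shows that the trace defining the fidelity is finite, so that its `toReal` is no junk
value. -/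
lemma exists_hsInner_eq_fidelity {ρ σ : K →L[ℂ] K} (hρ : IsDensity ρ) (hσ : IsDensity σ) :
    posTrace (CFC.sqrt (CFC.sqrt ρ * σ * CFC.sqrt ρ)) < ∞ ∧
    ∃ C : K →L[ℂ] K, ‖C‖ ≤ 1 ∧ hsInner (CFC.sqrt ρ) (C * CFC.sqrt σ) = fidelity ρ σ := by
  obtain ⟨V, hV, hVM, -⟩ := exists_mul_eq_of_norm_le
    fun x => (norm_sqrt_sqrt_mul_mul_sqrt_apply ρ hσ.1 x).le
  have hN := isPositive_sqrt (CFC.sqrt ρ * σ * CFC.sqrt ρ)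
  have hBV : IsHS (CFC.sqrt σ * V†) := hσ.isHS_sqrt.mul_right (norm_adjoint_le_one hV)
  have ht := hasTrace_adjoint_mul hBV hρ.isHS_sqrt
  rw [← hBV.hsInner_adjoint hρ.isHS_sqrt, adjoint_mul, ContinuousLinearMap.adjoint_adjoint,
    adjoint_sqrt, adjoint_sqrt, mul_assoc, hVM] at ht
  have hfin : posTrace (CFC.sqrt (CFC.sqrt ρ * σ * CFC.sqrt ρ)) < ∞ := by
    rw [ht.posTrace_eq hN]; exact ENNReal.ofReal_lt_top
  exact ⟨hfin, V, hV, HasSum.unique ht (hasTrace_of_isPositive hN hfin)⟩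

lemma fidelity_nonneg (ρ σ : K →L[ℂ] K) : 0 ≤ fidelity ρ σ := ENNReal.toReal_nonneg

lemma fidelity_le_one {ρ σ : K →L[ℂ] K} (hρ : IsDensity ρ) (hσ : IsDensity σ) :
    fidelity ρ σ ≤ 1 := by
  obtain ⟨-, C, hC, h⟩ := exists_hsInner_eq_fidelity hρ hσ
  have h1 := hρ.isHS_sqrt.norm_hsInner_le (hσ.isHS_sqrt.mul_left hC)
  rw [h, Complex.norm_of_nonneg (fidelity_nonneg _ _), hρ.hsNormSq_sqrt] at h1
  have h2 := ENNReal.toReal_mono (by simp) ((hsNormSq_mul_le hC _).trans_eq hσ.hsNormSq_sqrt)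
  rw [ENNReal.toReal_one] at h1 h2
  linarith

/-- The variational characterization of the fidelity, upper bound: `|Tr (√ρ C √σ)| ≤ F(ρ, σ)` for
every contraction `C`. With the polar decomposition `√σ √ρ = W N` the trace is that of
`(C W √N) √N`, a Hilbert–Schmidt inner product. -/
lemma norm_hsInner_le_fidelity {ρ σ : K →L[ℂ] K} (hρ : IsDensity ρ) (hσ : IsDensity σ)
    {C : K →L[ℂ] K} (hC : ‖C‖ ≤ 1) :
    ‖hsInner (CFC.sqrt ρ) (C * CFC.sqrt σ)‖ ≤ fidelity ρ σ := by
  obtain ⟨hfin, -⟩ := exists_hsInner_eq_fidelity hρ hσ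
  obtain ⟨W, hW, hWN, -⟩ := exists_mul_eq_of_norm_le
    fun x => (norm_sqrt_sqrt_mul_mul_sqrt_apply ρ hσ.1 x).ge
  unfold fidelity
  generalize hNdef : CFC.sqrt (CFC.sqrt ρ * σ * CFC.sqrt ρ) = N at hfin hWN
  have hN : N.IsPositive := hNdef ▸ isPositive_sqrt _
  have hR : IsHS (CFC.sqrt N) := by rwa [isHS_iff, ← posTrace_eq_hsNormSq_sqrt hN]
  have hBC : IsHS (CFC.sqrt σ * C†) := hσ.isHS_sqrt.mul_right (norm_adjoint_le_one hC)
  have ht := hasTrace_adjoint_mul hBC hρ.isHS_sqrt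
  rw [← hBC.hsInner_adjoint hρ.isHS_sqrt, adjoint_mul, ContinuousLinearMap.adjoint_adjoint,
    adjoint_sqrt, adjoint_sqrt, mul_assoc] at ht
  have hD : ‖(C * W)†‖ ≤ 1 :=
    norm_adjoint_le_one ((norm_mul_le _ _).trans (mul_le_one₀ hC (norm_nonneg _) hW))
  have hRD : IsHS (CFC.sqrt N * (C * W)†) := hR.mul_right hD
  have ht' := hasTrace_adjoint_mul hRD hR
  rw [adjoint_mul, ContinuousLinearMap.adjoint_adjoint, adjoint_sqrt, mul_assoc,
    sqrt_mul_sqrt hN, mul_assoc, hWN] at ht'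
  rw [HasSum.unique ht ht', posTrace_eq_hsNormSq_sqrt hN]
  refine (hRD.norm_hsInner_le hR).trans ?_
  have := ENNReal.toReal_mono (isHS_iff.1 hR).ne (hsNormSq_mul_le' hD (CFC.sqrt N))
  linarith

lemma hsInner_conj (S T : K →L[ℂ] K) : starRingEnd ℂ (hsInner S T) = hsInner T S := by
  rw [hsInner, Complex.conj_tsum]
  exact tsum_congr fun i => inner_conj_symm _ _

lemma hsInner_mul_right (S D T : K →L[ℂ] K) : hsInner S (D * T) = hsInner (D† * S) T :=
  tsum_congr fun i => by
    rw [mul_apply_eq_comp, mul_apply_eq_comp, ContinuousLinearMap.adjoint_inner_left]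

lemma ext_basis {S T : K →L[ℂ] K} (h : ∀ i, S (basis K i) = T (basis K i)) : S = T := by
  refine ContinuousLinearMap.ext_on
    (Submodule.dense_iff_topologicalClosure_eq_top.2 (basis K).dense_span) ?_
  rintro _ ⟨i, rfl⟩
  exact h i

/-- Equality in the Cauchy–Schwarz inequality for Hilbert–Schmidt operators of norm one. -/
lemma eq_of_hsInner_eq_one {S T : K →L[ℂ] K} (hS : IsHS S) (hT : IsHS T)
    (hS1 : hsNormSq S ≤ 1) (hT1 : hsNormSq T ≤ 1) (h : hsInner S T = 1) : S = T := by
  have h1 := ENNReal.toReal_mono (by simp) hS1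
  have h2 := ENNReal.toReal_mono (by simp) hT1
  rw [ENNReal.toReal_one] at h1 h2
  have hre := Complex.reCLM.hasSum (hS.hasSum_hsInner hT)
  have hsum := ((Summable.hasSum hS).sub (hre.mul_left 2)).add (Summable.hasSum hT)
  rw [hS.tsum_eq, hT.tsum_eq, h, Complex.reCLM_apply, Complex.one_re] at hsum
  have hsum' : HasSum (fun i => ‖S (basis K i) - T (basis K i)‖ ^ 2) _ :=
    hsum.congr_fun fun i => norm_sub_sq (𝕜 := ℂ) _ _
  refine ext_basis fun i => ?_
  have h3 := le_hasSum hsum' i fun j _ => by positivity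
  have h4 : ‖S (basis K i) - T (basis K i)‖ = 0 :=
    pow_eq_zero_iff two_ne_zero |>.1 (le_antisymm (by linarith) (sq_nonneg _))
  exact sub_eq_zero.1 (norm_eq_zero.1 h4)

/-- If `Tr (√ρ C √σ) = 1` then `√ρ = C √σ` and `√σ = C† √ρ`, and therefore `ρ = σ`. -/
lemma eq_of_fidelity_eq_one {ρ σ : K →L[ℂ] K} (hρ : IsDensity ρ) (hσ : IsDensity σ)
    (h : fidelity ρ σ = 1) : ρ = σ := by
  obtain ⟨-, C, hC, hF⟩ := exists_hsInner_eq_fidelity hρ hσ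
  rw [h, Complex.ofReal_one] at hF
  have hC' := norm_adjoint_le_one hC
  have h1 : CFC.sqrt ρ = C * CFC.sqrt σ :=
    eq_of_hsInner_eq_one hρ.isHS_sqrt (hσ.isHS_sqrt.mul_left hC) hρ.hsNormSq_sqrt.le
      ((hsNormSq_mul_le hC _).trans hσ.hsNormSq_sqrt.le) hF
  have h2 : C† * CFC.sqrt ρ = CFC.sqrt σ :=
    eq_of_hsInner_eq_one (hρ.isHS_sqrt.mul_left hC') hσ.isHS_sqrt
      ((hsNormSq_mul_le hC' _).trans hρ.hsNormSq_sqrt.le) hσ.hsNormSq_sqrt.le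
      (by rw [← hsInner_mul_right, hF])
  have h3 : CFC.sqrt ρ = CFC.sqrt σ * C† := by
    rw [← adjoint_sqrt ρ, h1, adjoint_mul, adjoint_sqrt]
  calc ρ = CFC.sqrt ρ * CFC.sqrt ρ := (sqrt_mul_sqrt hρ.1).symm
    _ = CFC.sqrt σ * (C† * CFC.sqrt ρ) := by rw [← mul_assoc, ← h3]
    _ = σ := by rw [h2, sqrt_mul_sqrt hσ.1]

/-! ### Block positivity -/

section

variable {E : Type*} [NormedAddCommGroup E] [InnerProductSpace ℂ E]

lemma posSemidef_of_sum_nonneg {ι : Type*} [Fintype ι] {M : Matrix ι ι ℂ}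
    (h : ∀ a : ι → ℂ, 0 ≤ ∑ i, ∑ j, starRingEnd ℂ (a i) * M i j * a j) : M.PosSemidef := by
  classical
  rw [← Matrix.isPositive_toEuclideanLin_iff, LinearMap.isPositive_iff_complex]
  intro x
  have e : inner ℂ (M.toEuclideanLin x) x =
      starRingEnd ℂ (∑ i, ∑ j, starRingEnd ℂ (x i) * M i j * x j) := by
    rw [← inner_conj_symm]
    congr 1
    simp [PiLp.inner_apply, Matrix.toLpLin_apply, Matrix.mulVec, dotProduct, Finset.mul_sum,
      mul_comm, mul_left_comm, mul_assoc]
  obtain ⟨r, hr, hr'⟩ := RCLike.nonneg_iff_exists_ofReal.1 (h x)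
  rw [e, ← hr']
  simpa using hr

/-- The Gram-type matrices of a positive block operator are positive semidefinite. -/
lemma BlockPositive.posSemidef {n : ℕ} {A : Fin n → Fin n → E →L[ℂ] E} (hA : BlockPositive A)
    {κ : Type*} [Fintype κ] (x : Fin n → κ → E) :
    (Matrix.of fun a b : Fin n × κ =>
      inner ℂ (x a.1 a.2) (A a.1 b.1 (x b.1 b.2))).PosSemidef := by
  refine posSemidef_of_sum_nonneg fun a => ?_
  refine (hA fun i => ∑ k, a (i, k) • x i k).trans_eq ?_
  have e (i j : Fin n) : inner ℂ (∑ k, a (i, k) • x i k) (A i j (∑ l, a (j, l) • x j l)) =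
      ∑ k, ∑ l, starRingEnd ℂ (a (i, k)) * inner ℂ (x i k) (A i j (x j l)) * a (j, l) := by
    rw [sum_inner]
    refine Finset.sum_congr rfl fun k _ => ?_
    rw [map_sum, inner_sum]
    refine Finset.sum_congr rfl fun l _ => ?_
    rw [map_smul, inner_smul_left, inner_smul_right]
    ring
  simp only [e, Fintype.sum_prod_type, Matrix.of_apply]
  exact Finset.sum_congr rfl fun i _ => Finset.sum_comm

lemma sum_nonneg_of_posSemidef {ι : Type*} [Fintype ι] {M : Matrix ι ι ℂ} (hM : M.PosSemidef) :
    0 ≤ ∑ i, ∑ j, M i j := by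
  simpa [dotProduct, Matrix.mulVec] using hM.dotProduct_mulVec_nonneg 1

/-- The off-diagonal blocks of a positive `2 × 2` block operator are adjoint to each other. -/
lemma BlockPositive.inner_off_diag {A : Fin 2 → Fin 2 → E →L[ℂ] E} (hA : BlockPositive A)
    (x y : E) : inner ℂ y (A 1 0 x) = starRingEnd ℂ (inner ℂ x (A 0 1 y)) := by
  have h := hA.posSemidef (κ := Unit) fun i _ => ![x, y] i
  simpa using (h.isHermitian.apply (1, ()) (0, ())).symm

/-- The Cauchy–Schwarz inequality for a positive `2 × 2` block operator. -/
lemma BlockPositive.norm_inner_sq_le {A : Fin 2 → Fin 2 → E →L[ℂ] E} (hA : BlockPositive A)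
    (x y : E) :
    ((‖inner ℂ x (A 0 1 y)‖ ^ 2 : ℝ) : ℂ) ≤ inner ℂ x (A 0 0 x) * inner ℂ y (A 1 1 y) := by
  have h := ((hA.posSemidef (κ := Unit) fun i _ => ![x, y] i).submatrix
    (fun i : Fin 2 => (i, ()))).det_nonneg
  rw [Matrix.det_fin_two] at h
  simp only [Matrix.submatrix_apply, Matrix.of_apply, Matrix.cons_val_zero,
    Matrix.cons_val_one, hA.inner_off_diag x y, Complex.mul_conj,
    Complex.normSq_eq_norm_sq] at h
  exact sub_nonneg.1 h

lemma BlockPositive.isPositive {A : E →L[ℂ] E} (hA : BlockPositive fun _ _ : Fin 1 => A) :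
    A.IsPositive := by
  refine ContinuousLinearMap.isPositive_iff_complex A |>.2 fun x => ?_
  obtain ⟨r, hr, hr'⟩ := RCLike.nonneg_iff_exists_ofReal.1 (hA fun _ => x)
  simp only [Finset.univ_unique, Finset.sum_const, Finset.card_singleton, one_smul] at hr'
  rw [← inner_conj_symm, ← hr']
  simpa using hr

lemma blockPositive_of_isPositive {A : E →L[ℂ] E} (hA : A.IsPositive) :
    BlockPositive fun _ _ : Fin 1 => A := fun x => by
  simpa using hA.inner_nonneg_right (x 0)

end

/-! ### The upper bound -/

lemma posTrace_rankOne (ψ : H) :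
    posTrace (InnerProductSpace.rankOne ℂ ψ ψ) = ENNReal.ofReal (‖ψ‖ ^ 2) := by
  rw [← tsum_ofReal_norm_sq_inner_basis]
  refine tsum_congr fun i => ?_
  rw [InnerProductSpace.rankOne_apply, inner_smul_right, ← inner_conj_symm, mul_comm,
    Complex.mul_conj, Complex.ofReal_re, Complex.normSq_eq_norm_sq]

lemma rankOne_mem_traceClass (φ ψ : H) : InnerProductSpace.rankOne ℂ φ ψ ∈ traceClass H := by
  have e : InnerProductSpace.rankOne ℂ φ ψ = (1 / 4 : ℂ) • (ketbra (φ + ψ) - ketbra (φ - ψ) +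
      (Complex.I • ketbra (φ + Complex.I • ψ) - Complex.I • ketbra (φ - Complex.I • ψ)) :
        traceClass H) := by
    ext x
    simp only [ketbra, Submodule.coe_smul, Submodule.coe_add, Submodule.coe_sub, smul_apply,
      add_apply, sub_apply, InnerProductSpace.rankOne_apply, inner_add_left, inner_sub_left,
      inner_smul_left, Complex.conj_I, smul_add, smul_sub, smul_smul, add_smul, sub_smul]
    match_scalars
    · linear_combination inner ℂ ψ x / 2 * Complex.I_sq
    · linear_combination -(inner ℂ φ x / 2) * Complex.I_sq
  rw [e]
  exact (traceClass H).smul_mem _ (Subtype.coe_prop _)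

/-- The operator `|φ⟩⟨ψ|`, as a trace-class operator. -/
def ketbra₂ (φ ψ : H) : traceClass H :=
  ⟨InnerProductSpace.rankOne ℂ φ ψ, rankOne_mem_traceClass φ ψ⟩

lemma blockPositive_ketbra₂ {n : ℕ} (ψ : Fin n → H) :
    BlockPositive fun i j => (ketbra₂ (ψ i) (ψ j) : H →L[ℂ] H) := by
  intro x
  have e : ∑ i, ∑ j, inner ℂ (x i) ((ketbra₂ (ψ i) (ψ j) : H →L[ℂ] H) (x j)) =
      (∑ i, inner ℂ (x i) (ψ i)) * starRingEnd ℂ (∑ i, inner ℂ (x i) (ψ i)) := by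
    simp [ketbra₂, Finset.mul_sum, mul_comm]
  rw [e]
  exact mul_star_self_nonneg _

lemma QuantumOperation.map_isPositive (E : QuantumOperation H K) {T : traceClass H}
    (hT : (T : H →L[ℂ] H).IsPositive) : (E.map T : K →L[ℂ] K).IsPositive :=
  BlockPositive.isPositive
    (E.completely_positive 1 (fun _ _ => T) (blockPositive_of_isPositive hT))

lemma QuantumOperation.prob_nonneg (E : QuantumOperation H K) (ψ : H) : 0 ≤ E.prob ψ :=
  ENNReal.toReal_nonneg

lemma QuantumOperation.prob_le_one (E : QuantumOperation H K) {ψ : H} (hψ : ‖ψ‖ = 1) :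
    E.prob ψ ≤ 1 := by
  have h : posTrace (ketbra ψ : H →L[ℂ] H) = 1 := by
    rw [ketbra, posTrace_rankOne, hψ]; simp
  have := E.trace_le (ketbra ψ) (InnerProductSpace.isPositive_rankOne_self ψ)
  rw [h] at this
  exact (ENNReal.toReal_mono (by simp) this).trans_eq ENNReal.toReal_one

/-- The interference term `E(|ψ₁⟩⟨ψ₂|)` of an operation that realizes `ψᵢ → ρᵢ` has a trace of modulus
at most `√(p₁ p₂) F(ρ₁, ρ₂)`. -/
lemma QuantumOperation.exists_hasTrace_ketbra₂ (E : QuantumOperation H K) {ψ₁ ψ₂ : H}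
    {ρ₁ ρ₂ : K →L[ℂ] K} (hρ₁ : IsDensity ρ₁) (hρ₂ : IsDensity ρ₂) (h₁ : E.Sends ψ₁ ρ₁)
    (h₂ : E.Sends ψ₂ ρ₂) :
    ∃ τ : ℂ, ‖τ‖ ≤ √(E.prob ψ₁) * √(E.prob ψ₂) * fidelity ρ₁ ρ₂ ∧
      HasTrace (E.map (ketbra₂ ψ₁ ψ₂) : K →L[ℂ] K) τ ∧
      HasTrace (E.map (ketbra₂ ψ₂ ψ₁) : K →L[ℂ] K) (starRingEnd ℂ τ) := by
  have hp₁ := E.prob_nonneg ψ₁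
  have hp₂ := E.prob_nonneg ψ₂
  have hY := E.completely_positive 2 _ (blockPositive_ketbra₂ ![ψ₁, ψ₂])
  have h₁' : (E.map (ketbra₂ ψ₁ ψ₁) : K →L[ℂ] K) = (E.prob ψ₁ : ℂ) • ρ₁ := h₁
  have h₂' : (E.map (ketbra₂ ψ₂ ψ₂) : K →L[ℂ] K) = (E.prob ψ₂ : ℂ) • ρ₂ := h₂
  have hsqrt {ρ : K →L[ℂ] K} (hρ : IsDensity ρ) {p : ℝ} (hp : 0 ≤ p) (x : K) :
      inner ℂ x (((p : ℂ) • ρ) x) = ((‖(((√p : ℝ) : ℂ) • CFC.sqrt ρ) x‖ ^ 2 : ℝ) : ℂ) := by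
    rw [smul_apply, inner_smul_right, ← inner_sqrt_apply_sqrt hρ.1, inner_self_eq_norm_sq_to_K,
      smul_apply, norm_smul, mul_pow, Complex.norm_of_nonneg (Real.sqrt_nonneg p),
      Real.sq_sqrt hp]
    simp
  obtain ⟨C, hC, hX⟩ := exists_eq_adjoint_mul_mul (X := (E.map (ketbra₂ ψ₁ ψ₂) : K →L[ℂ] K))
    (A := ((√(E.prob ψ₁) : ℝ) : ℂ) • CFC.sqrt ρ₁) (B := ((√(E.prob ψ₂) : ℝ) : ℂ) • CFC.sqrt ρ₂)
    fun x y => by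
      have h := hY.norm_inner_sq_le x y
      simp only [Matrix.cons_val_zero, Matrix.cons_val_one, h₁', h₂'] at h
      rw [hsqrt hρ₁ hp₁, hsqrt hρ₂ hp₂, ← Complex.ofReal_mul, Complex.real_le_real,
        ← mul_pow] at h
      exact (sq_le_sq₀ (norm_nonneg _) (by positivity)).1 h
  have hX' : (E.map (ketbra₂ ψ₁ ψ₂) : K →L[ℂ] K) =
      ((√(E.prob ψ₁) * √(E.prob ψ₂) : ℝ) : ℂ) • ((CFC.sqrt ρ₁)† * (C * CFC.sqrt ρ₂)) := by
    rw [hX, map_smulₛₗ, Complex.conj_ofReal, smul_mul_assoc, mul_smul_comm, mul_smul_comm,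
      smul_smul, Complex.ofReal_mul]
  have hT : HasTrace (E.map (ketbra₂ ψ₁ ψ₂) : K →L[ℂ] K) _ :=
    hX' ▸ (hasTrace_adjoint_mul hρ₁.isHS_sqrt (hρ₂.isHS_sqrt.mul_left hC)).smul _
  refine ⟨_, ?_, hT, ?_⟩
  · rw [norm_mul, Complex.norm_of_nonneg (by positivity)]
    gcongr
    exact norm_hsInner_le_fidelity hρ₁ hρ₂ hC
  · refine (Complex.hasSum_conj'.2 hT).congr_fun fun i => ?_
    simpa using hY.inner_off_diag (basis K i) (basis K i)

/-- The trace of `E(|ψ₁ - ψ₂⟩⟨ψ₁ - ψ₂|)` is `p₁ + p₂` minus an interference term controlled by the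
fidelity, and it is at most `‖ψ₁ - ψ₂‖²`. -/
lemma QuantumOperation.mean_prob_mul_le (E : QuantumOperation H K) {ψ₁ ψ₂ : H}
    (hψ₁ : ‖ψ₁‖ = 1) (hψ₂ : ‖ψ₂‖ = 1) {s : ℝ} (hs : inner ℂ ψ₁ ψ₂ = (s : ℂ))
    {ρ₁ ρ₂ : K →L[ℂ] K} (hρ₁ : IsDensity ρ₁) (hρ₂ : IsDensity ρ₂) (h₁ : E.Sends ψ₁ ρ₁)
    (h₂ : E.Sends ψ₂ ρ₂) :
    (E.prob ψ₁ + E.prob ψ₂) / 2 * (1 - fidelity ρ₁ ρ₂) ≤ 1 - s := by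
  obtain ⟨τ, hτ, hX, hX'⟩ := E.exists_hasTrace_ketbra₂ hρ₁ hρ₂ h₁ h₂
  have e : ketbra (ψ₁ - ψ₂) = ketbra ψ₁ + (-1 : ℂ) • ketbra₂ ψ₁ ψ₂ + (-1 : ℂ) • ketbra₂ ψ₂ ψ₁ +
      ketbra ψ₂ := by
    ext x
    simp only [ketbra, ketbra₂, Submodule.coe_smul, Submodule.coe_add, smul_apply, add_apply,
      InnerProductSpace.rankOne_apply, inner_sub_left, smul_sub, sub_smul]
    module
  have ht : HasTrace (E.map (ketbra (ψ₁ - ψ₂)) : K →L[ℂ] K)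
      (E.prob ψ₁ * 1 + -1 * τ + -1 * starRingEnd ℂ τ + E.prob ψ₂ * 1) := by
    simp only [e, map_add, map_smul, Submodule.coe_add, Submodule.coe_smul]
    rw [show (E.map (ketbra ψ₁) : K →L[ℂ] K) = _ from h₁,
      show (E.map (ketbra ψ₂) : K →L[ℂ] K) = _ from h₂]
    exact (((hρ₁.hasTrace.smul _).add (hX.smul _)).add (hX'.smul _)).add (hρ₂.hasTrace.smul _)
  have hpos := InnerProductSpace.isPositive_rankOne_self (𝕜 := ℂ) (ψ₁ - ψ₂)
  have hle := E.trace_le (ketbra (ψ₁ - ψ₂)) hpos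
  rw [ht.posTrace_eq (E.map_isPositive hpos), ketbra, posTrace_rankOne,
    ENNReal.ofReal_le_ofReal_iff (by positivity), norm_sub_sq (𝕜 := ℂ), hs, hψ₁, hψ₂] at hle
  simp at hle
  have hre := (Complex.re_le_norm τ).trans hτ
  -- What remains is `|Tr X| ≤ √(p₁ p₂) F ≤ (p₁ + p₂) / 2 * F`.
  have hp₁ := Real.sq_sqrt (E.prob_nonneg ψ₁)
  have hp₂ := Real.sq_sqrt (E.prob_nonneg ψ₂)
  have hF := fidelity_nonneg ρ₁ ρ₂
  have hamgm : √(E.prob ψ₁) * √(E.prob ψ₂) ≤ (E.prob ψ₁ + E.prob ψ₂) / 2 := by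
    nlinarith [sq_nonneg (√(E.prob ψ₁) - √(E.prob ψ₂))]
  nlinarith [mul_le_mul_of_nonneg_right hamgm hF]

/-! ### Operations on a finite-dimensional subspace -/

/-- Bessel's inequality for the trace. -/
lemma ofReal_sum_inner_le_posTrace {n : ℕ} {v : Fin n → H} (hv : Orthonormal ℂ v)
    {T : H →L[ℂ] H} (hT : T.IsPositive) :
    ENNReal.ofReal (∑ k, (inner ℂ (v k) (T (v k))).re) ≤ posTrace T := by
  have e (k : Fin n) : ENNReal.ofReal (inner ℂ (v k) (T (v k))).re =
      ∑' i, ENNReal.ofReal (‖inner ℂ (v k) (CFC.sqrt T (basis H i))‖ ^ 2) := by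
    rw [← inner_sqrt_apply_sqrt hT, inner_self_eq_norm_sq_to_K]
    have h : ((‖CFC.sqrt T (v k)‖ : ℂ) ^ 2).re = ‖CFC.sqrt T (v k)‖ ^ 2 := by norm_cast
    refine (congrArg ENNReal.ofReal h).trans ?_
    rw [← tsum_ofReal_norm_sq_inner_basis]
    refine tsum_congr fun i => ?_
    rw [← adjoint_sqrt, ContinuousLinearMap.adjoint_inner_right, ← inner_conj_symm,
      RCLike.norm_conj]
    simp only [adjoint_sqrt]
  have hnn (k : Fin n) : 0 ≤ (inner ℂ (v k) (T (v k))).re := hT.re_inner_nonneg_right _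
  rw [ENNReal.ofReal_sum_of_nonneg fun k _ => hnn k,
    posTrace_eq_hsNormSq_sqrt hT]
  simp_rw [e]
  rw [← Summable.tsum_finsetSum fun _ _ => ENNReal.summable]
  refine ENNReal.tsum_le_tsum fun i => ?_
  rw [← ENNReal.ofReal_sum_of_nonneg fun _ _ => by positivity]
  exact ENNReal.ofReal_le_ofReal (hv.sum_inner_products_le _)

/-- The map `T ↦ ∑ i j, ⟨φ i, T φ j⟩ Y i j`. If `φ` is dual to a family `ψ`, it sends
`|ψ i⟩⟨ψ j|` to `Y i j`. -/
def schurMap {n : ℕ} (φ : Fin n → H) (Y : Fin n → Fin n → traceClass K) :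
    traceClass H →ₗ[ℂ] traceClass K where
  toFun T := ∑ i, ∑ j, inner ℂ (φ i) ((T : H →L[ℂ] H) (φ j)) • Y i j
  map_add' S T := by
    simp [add_smul, Finset.sum_add_distrib]
  map_smul' c T := by
    simp [Finset.smul_sum, mul_smul]

lemma coe_schurMap {n : ℕ} (φ : Fin n → H) (Y : Fin n → Fin n → traceClass K)
    (T : traceClass H) :
    (schurMap φ Y T : K →L[ℂ] K) =
      ∑ i, ∑ j, inner ℂ (φ i) ((T : H →L[ℂ] H) (φ j)) • (Y i j : K →L[ℂ] K) := by
  simp [schurMap]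

/-- Complete positivity of `schurMap`, by the Schur product theorem. -/
lemma blockPositive_schurMap {m n : ℕ} (φ : Fin m → H) {Y : Fin m → Fin m → traceClass K}
    (hY : BlockPositive fun i j => (Y i j : K →L[ℂ] K)) {T : Fin n → Fin n → traceClass H}
    (hT : BlockPositive fun k l => (T k l : H →L[ℂ] H)) :
    BlockPositive fun k l => (schurMap φ Y (T k l) : K →L[ℂ] K) := by
  intro x
  have h1 := hT.posSemidef fun _ => φ
  have h2 := (hY.posSemidef fun _ => x).submatrix (Prod.swap : Fin n × Fin m → Fin m × Fin n)
  have h := sum_nonneg_of_posSemidef (h1.hadamard h2)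
  simp only [Fintype.sum_prod_type, Matrix.hadamard_apply, Matrix.submatrix_apply,
    Matrix.of_apply, Prod.fst_swap, Prod.snd_swap] at h
  refine h.trans_eq (Finset.sum_congr rfl fun k _ => ?_)
  rw [Finset.sum_comm]
  refine Finset.sum_congr rfl fun l _ => ?_
  simp [coe_schurMap]

lemma hasTrace_schurMap {n : ℕ} (φ : Fin n → H) {Y : Fin n → Fin n → traceClass K}
    {y : Fin n → Fin n → ℂ} (hY : ∀ i j, HasTrace (Y i j : K →L[ℂ] K) (y i j))
    (T : traceClass H) :
    HasTrace (schurMap φ Y T : K →L[ℂ] K)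
      (∑ i, ∑ j, inner ℂ (φ i) ((T : H →L[ℂ] H) (φ j)) * y i j) := by
  have h : HasSum _ _ := hasSum_sum (s := Finset.univ) fun i _ =>
    hasSum_sum (s := Finset.univ) fun j _ =>
      (hY i j).smul (inner ℂ (φ i) ((T : H →L[ℂ] H) (φ j)))
  exact h.congr_fun fun k => by simp [coe_schurMap]

/-- A map `schurMap φ Y` as a quantum operation, where the block `Y i j` has trace `y i j`. The trace
does not increase if `Tr (schurMap φ Y T)` is at most the sum of the diagonal entries of `T` along
an orthonormal family `v`, by Bessel's inequality. -/
def schurOperation {m n : ℕ} (φ : Fin n → H) (Y : Fin n → Fin n → traceClass K)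
    (hY : BlockPositive fun i j => (Y i j : K →L[ℂ] K))
    (y : Fin n → Fin n → ℂ) (hy : ∀ i j, HasTrace (Y i j : K →L[ℂ] K) (y i j))
    (v : Fin m → H) (hv : Orthonormal ℂ v)
    (h : ∀ T : H →L[ℂ] H, T.IsPositive →
      (∑ i, ∑ j, inner ℂ (φ i) (T (φ j)) * y i j).re ≤ ∑ k, (inner ℂ (v k) (T (v k))).re) :
    QuantumOperation H K where
  map := schurMap φ Y
  completely_positive _ _ hT := blockPositive_schurMap φ hY hT
  trace_le T hT := by
    have hpos : (schurMap φ Y T : K →L[ℂ] K).IsPositive :=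
      BlockPositive.isPositive (blockPositive_schurMap φ hY (T := fun _ _ : Fin 1 => T)
        (blockPositive_of_isPositive hT))
    rw [(hasTrace_schurMap φ hy T).posTrace_eq hpos]
    exact (ENNReal.ofReal_le_ofReal (h T hT)).trans (ofReal_sum_inner_le_posTrace hv hT)

lemma QuantumOperation.prob_eq_of_map_eq {E : QuantumOperation H K} {ψ : H} {ρ : K →L[ℂ] K}
    (hρ : IsDensity ρ) {p : ℝ} (hp : 0 ≤ p) (h : (E.map (ketbra ψ) : K →L[ℂ] K) = (p : ℂ) • ρ) :
    E.prob ψ = p := by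
  have hpos := E.map_isPositive (T := ketbra ψ) (InnerProductSpace.isPositive_rankOne_self ψ)
  have ht : HasTrace (E.map (ketbra ψ) : K →L[ℂ] K) (p * 1) := h ▸ hρ.hasTrace.smul _
  rw [QuantumOperation.prob, ht.posTrace_eq hpos]
  simpa using hp

lemma IsDensity.mem_traceClass {ρ : K →L[ℂ] K} (hρ : IsDensity ρ) : ρ ∈ traceClass K :=
  Submodule.subset_span ⟨hρ.1, by simp [hρ.2]⟩

/-- The operation `T ↦ p ⟨ψ, T ψ⟩ ρ`. -/
lemma exists_operation_of_eq {ψ : H} (hψ : ‖ψ‖ = 1) {ρ : K →L[ℂ] K} (hρ : IsDensity ρ) {p : ℝ}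
    (hp0 : 0 ≤ p) (hp1 : p ≤ 1) :
    ∃ E : QuantumOperation H K, (E.map (ketbra ψ) : K →L[ℂ] K) = (p : ℂ) • ρ := by
  have hpc : (0 : ℂ) ≤ p := by exact_mod_cast hp0
  let E := schurOperation (fun _ : Fin 1 => ψ)
    (fun _ _ => ⟨(p : ℂ) • ρ, (traceClass K).smul_mem _ hρ.mem_traceClass⟩)
    (blockPositive_of_isPositive (hρ.1.smul_of_nonneg hpc))
    (fun _ _ => p * 1) (fun _ _ => hρ.hasTrace.smul _) (fun _ : Fin 1 => ψ)
    ⟨fun _ => hψ, fun i j hij => (hij (Subsingleton.elim i j)).elim⟩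
    (fun T hT => by
      have := hT.re_inner_nonneg_right ψ
      simp only [Finset.univ_unique, Finset.sum_const, Finset.card_singleton, one_smul, mul_one,
        Complex.re_mul_ofReal]
      exact mul_le_of_le_one_right this hp1)
  refine ⟨E, ?_⟩
  change ((schurMap _ _ (ketbra ψ) : traceClass K) : K →L[ℂ] K) = _
  simp [coe_schurMap, ketbra, inner_self_eq_norm_sq_to_K, hψ]

/-- An operation `T ↦ p ∑ i j, ⟨φ i, T φ j⟩ Y i j`, where `Y` has diagonal blocks `ρ₁`, `ρ₂` and
off-diagonal blocks `√ρ₁ C √ρ₂` and its adjoint, of trace `t`. The vectors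
`φ = (a u + b v, a u - b v)` are given by their orthogonal directions `u` and `v`, along which the
trace of the image is diagonal. -/
lemma exists_operation_of_orthonormal {u v : H} (huv : Orthonormal ℂ ![u, v]) {a b p t : ℝ}
    (hp : 0 ≤ p) (ha : 2 * p * (1 + t) * a ^ 2 ≤ 1) (hb : 2 * p * (1 - t) * b ^ 2 ≤ 1)
    {ρ₁ ρ₂ : K →L[ℂ] K} (hρ₁ : IsDensity ρ₁) (hρ₂ : IsDensity ρ₂) {C : K →L[ℂ] K} (hC : ‖C‖ ≤ 1)
    (ht : hsInner (CFC.sqrt ρ₁) (C * CFC.sqrt ρ₂) = t) :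
    ∃ E : QuantumOperation H K, ∀ ψ : H,
      (inner ℂ ((a : ℂ) • u + (b : ℂ) • v) ψ = 1 → inner ℂ ((a : ℂ) • u - (b : ℂ) • v) ψ = 0 →
        (E.map (ketbra ψ) : K →L[ℂ] K) = (p : ℂ) • ρ₁) ∧
      (inner ℂ ((a : ℂ) • u + (b : ℂ) • v) ψ = 0 → inner ℂ ((a : ℂ) • u - (b : ℂ) • v) ψ = 1 →
        (E.map (ketbra ψ) : K →L[ℂ] K) = (p : ℂ) • ρ₂) := by
  have hCρ := hρ₂.isHS_sqrt.mul_left hC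
  set X : K →L[ℂ] K := (CFC.sqrt ρ₁)† * (C * CFC.sqrt ρ₂) with hX
  set X' : K →L[ℂ] K := (C * CFC.sqrt ρ₂)† * CFC.sqrt ρ₁ with hX'
  have hXm : X ∈ traceClass K := adjoint_mul_mem_traceClass hρ₁.isHS_sqrt hCρ
  have hXm' : X' ∈ traceClass K := adjoint_mul_mem_traceClass hCρ hρ₁.isHS_sqrt
  have hXt : HasTrace X t := ht ▸ hasTrace_adjoint_mul hρ₁.isHS_sqrt hCρ
  have hXt' : HasTrace X' t := by
    have := hasTrace_adjoint_mul hCρ hρ₁.isHS_sqrt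
    rwa [← hsInner_conj, ht, Complex.conj_ofReal] at this
  let Y : Fin 2 → Fin 2 → traceClass K := fun i j => (p : ℂ) •
    (![![⟨ρ₁, hρ₁.mem_traceClass⟩, ⟨X, hXm⟩], ![⟨X', hXm'⟩, ⟨ρ₂, hρ₂.mem_traceClass⟩]] i j :
      traceClass K)
  let y : Fin 2 → Fin 2 → ℂ := fun i j => (p : ℂ) * ![![1, (t : ℂ)], ![(t : ℂ), 1]] i j
  have hy i j : HasTrace (Y i j : K →L[ℂ] K) (y i j) := by
    refine HasTrace.smul ?_ _
    fin_cases i <;> fin_cases j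
    · exact hρ₁.hasTrace
    · exact hXt
    · exact hXt'
    · exact hρ₂.hasTrace
  have hY : BlockPositive fun i j => (Y i j : K →L[ℂ] K) := by
    intro x
    set z := CFC.sqrt ρ₁ (x 0)
    set w := CFC.sqrt ρ₂ (x 1)
    have e : ∑ i, ∑ j, inner ℂ (x i) ((Y i j : K →L[ℂ] K) (x j)) =
        p * (inner ℂ z z + inner ℂ z (C w) + inner ℂ (C w) z + inner ℂ w w) := by
      rw [inner_sqrt_apply_sqrt hρ₁.1, inner_sqrt_apply_sqrt hρ₂.1]
      simp only [Fin.sum_univ_two, Y, Submodule.coe_smul, smul_apply, inner_smul_right]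
      simp [hX, hX', ContinuousLinearMap.adjoint_inner_right, z, w]
      ring
    have e' : inner ℂ z z + inner ℂ z (C w) + inner ℂ (C w) z + inner ℂ w w =
        ((‖z + C w‖ ^ 2 + (‖w‖ ^ 2 - ‖C w‖ ^ 2) : ℝ) : ℂ) := by
      have h1 := inner_self_eq_norm_sq_to_K (𝕜 := ℂ) (z + C w)
      have h2 := inner_self_eq_norm_sq_to_K (𝕜 := ℂ) w
      have h3 := inner_self_eq_norm_sq_to_K (𝕜 := ℂ) (C w)
      simp only [inner_add_left, inner_add_right] at h1
      push_cast
      simp only [Complex.coe_algebraMap] at h1 h2 h3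
      linear_combination h1 + h2 - h3
    rw [e, e', ← Complex.ofReal_mul, Complex.zero_le_real]
    have hw := norm_apply_le_of_norm_le_one hC w
    have hw' : ‖C w‖ ^ 2 ≤ ‖w‖ ^ 2 := by gcongr
    exact mul_nonneg hp (by nlinarith [sq_nonneg ‖z + C w‖])
  let E := schurOperation ![(a : ℂ) • u + (b : ℂ) • v, (a : ℂ) • u - (b : ℂ) • v] Y hY y hy
    ![u, v] huv (fun T hT => by
      have hu := hT.re_inner_nonneg_right u
      have hv := hT.re_inner_nonneg_right v
      have e : ∑ i, ∑ j, inner ℂ (![(a : ℂ) • u + (b : ℂ) • v, (a : ℂ) • u - (b : ℂ) • v] i)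
          (T (![(a : ℂ) • u + (b : ℂ) • v, (a : ℂ) • u - (b : ℂ) • v] j)) * y i j =
          ((2 * p * (1 + t) * a ^ 2 : ℝ) : ℂ) * inner ℂ u (T u) +
            ((2 * p * (1 - t) * b ^ 2 : ℝ) : ℂ) * inner ℂ v (T v) := by
        simp only [Fin.sum_univ_two, y, Matrix.cons_val_zero, Matrix.cons_val_one, map_add, map_sub,
          map_smul, inner_add_left, inner_add_right, inner_sub_left, inner_sub_right,
          inner_smul_left, inner_smul_right, Complex.conj_ofReal]
        push_cast
        ring
      rw [e, Complex.add_re, Complex.re_ofReal_mul, Complex.re_ofReal_mul, Fin.sum_univ_two]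
      exact add_le_add (mul_le_of_le_one_left hu ha) (mul_le_of_le_one_left hv hb))
  refine ⟨E, fun ψ => ⟨fun h1 h2 => ?_, fun h1 h2 => ?_⟩⟩
  all_goals
    change ((schurMap _ _ (ketbra ψ) : traceClass K) : K →L[ℂ] K) = _
    have h1' := congrArg (starRingEnd ℂ) h1
    have h2' := congrArg (starRingEnd ℂ) h2
    rw [inner_conj_symm] at h1' h2'
    rw [coe_schurMap]
    generalize (a : ℂ) • u + (b : ℂ) • v = φ₁ at h1 h1' ⊢
    generalize (a : ℂ) • u - (b : ℂ) • v = φ₂ at h2 h2' ⊢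
    simp [ketbra, Fin.sum_univ_two, h1, h2, h1', h2', Y]

/-! ### The optimal operation -/

/-- Every value between `0` and the fidelity is of the form `Tr (√ρ C √σ)`, `C` a contraction. -/
lemma exists_hsInner_eq {ρ σ : K →L[ℂ] K} (hρ : IsDensity ρ) (hσ : IsDensity σ) {t : ℝ}
    (ht0 : 0 ≤ t) (ht : t ≤ fidelity ρ σ) :
    ∃ C : K →L[ℂ] K, ‖C‖ ≤ 1 ∧ hsInner (CFC.sqrt ρ) (C * CFC.sqrt σ) = t := by
  obtain ⟨-, C, hC, hF⟩ := exists_hsInner_eq_fidelity hρ hσ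
  have hr0 : 0 ≤ t / fidelity ρ σ := div_nonneg ht0 (fidelity_nonneg _ _)
  have hr1 : t / fidelity ρ σ ≤ 1 := div_le_one_of_le₀ ht (fidelity_nonneg _ _)
  refine ⟨((t / fidelity ρ σ : ℝ) : ℂ) • C, ?_, ?_⟩
  · rw [norm_smul, Complex.norm_of_nonneg hr0]
    exact mul_le_one₀ hr1 (norm_nonneg _) hC
  · have e : hsInner (CFC.sqrt ρ) ((((t / fidelity ρ σ : ℝ) : ℂ) • C) * CFC.sqrt σ) =
        ((t / fidelity ρ σ : ℝ) : ℂ) * hsInner (CFC.sqrt ρ) (C * CFC.sqrt σ) := by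
      rw [hsInner, hsInner, ← tsum_mul_left]
      exact tsum_congr fun i => by simp
    rw [e, hF, ← Complex.ofReal_mul]
    congr 1
    rcases (fidelity_nonneg ρ σ).eq_or_lt with h0 | h0
    · rw [← h0] at ht ⊢
      simp [le_antisymm ht ht0]
    · field_simp

/-- A balanced operation with success probability `p` on two distinct states with real overlap `s`.
It amounts to a map with `ψ₁ ↦ √p Ψ₁` and `ψ₂ ↦ √p Ψ₂` for purifications `Ψ₁`, `Ψ₂` of overlap `t`;
the two inequalities say that it does not increase the norms of `ψ₁ + ψ₂` and `ψ₁ - ψ₂`. -/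
lemma exists_operation_of_overlap {ψ₁ ψ₂ : H} (hψ₁ : ‖ψ₁‖ = 1) (hψ₂ : ‖ψ₂‖ = 1) {s : ℝ}
    (hs : inner ℂ ψ₁ ψ₂ = (s : ℂ)) (hs0 : 0 ≤ s) (hs1 : s < 1) {ρ₁ ρ₂ : K →L[ℂ] K}
    (hρ₁ : IsDensity ρ₁) (hρ₂ : IsDensity ρ₂) {p t : ℝ} (hp : 0 ≤ p) (ht0 : 0 ≤ t)
    (ht : t ≤ fidelity ρ₁ ρ₂) (h₁ : p * (1 + t) ≤ 1 + s) (h₂ : p * (1 - t) ≤ 1 - s) :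
    ∃ E : QuantumOperation H K, (E.map (ketbra ψ₁) : K →L[ℂ] K) = (p : ℂ) • ρ₁ ∧
      (E.map (ketbra ψ₂) : K →L[ℂ] K) = (p : ℂ) • ρ₂ := by
  obtain ⟨C, hC, hCt⟩ := exists_hsInner_eq hρ₁ hρ₂ ht0 ht
  have hs' : inner ℂ ψ₂ ψ₁ = (s : ℂ) := by
    rw [← inner_conj_symm, hs, Complex.conj_ofReal]
  have h11 : inner ℂ ψ₁ ψ₁ = (1 : ℂ) := by simp [inner_self_eq_norm_sq_to_K, hψ₁]
  have h22 : inner ℂ ψ₂ ψ₂ = (1 : ℂ) := by simp [inner_self_eq_norm_sq_to_K, hψ₂]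
  have hposa : (0 : ℝ) < 2 * (1 + s) := by linarith
  have hposb : (0 : ℝ) < 2 * (1 - s) := by linarith
  set a : ℝ := (√(2 * (1 + s)))⁻¹
  set b : ℝ := (√(2 * (1 - s)))⁻¹
  have ha : a ^ 2 = (2 * (1 + s))⁻¹ := by rw [inv_pow, Real.sq_sqrt hposa.le]
  have hb : b ^ 2 = (2 * (1 - s))⁻¹ := by rw [inv_pow, Real.sq_sqrt hposb.le]
  have ha' : (a : ℂ) * a = (2 * (1 + s : ℂ))⁻¹ := by rw [← sq]; exact_mod_cast ha
  have hb' : (b : ℂ) * b = (2 * (1 - s : ℂ))⁻¹ := by rw [← sq]; exact_mod_cast hb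
  have hnea : (1 + s : ℂ) ≠ 0 := by exact_mod_cast (by linarith : (1 + s : ℝ) ≠ 0)
  have hneb : (1 - s : ℂ) ≠ 0 := by exact_mod_cast (by linarith : (1 - s : ℝ) ≠ 0)
  have huu : inner ℂ ((a : ℂ) • (ψ₁ + ψ₂)) ((a : ℂ) • (ψ₁ + ψ₂)) = (1 : ℂ) := by
    simp only [inner_smul_left, inner_smul_right, inner_add_left, inner_add_right, h11, h22, hs,
      hs', Complex.conj_ofReal]
    linear_combination (2 * (1 + s) : ℂ) * ha' + mul_inv_cancel₀ (mul_ne_zero two_ne_zero hnea)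
  have hvv : inner ℂ ((b : ℂ) • (ψ₁ - ψ₂)) ((b : ℂ) • (ψ₁ - ψ₂)) = (1 : ℂ) := by
    simp only [inner_smul_left, inner_smul_right, inner_sub_left, inner_sub_right, h11, h22, hs,
      hs', Complex.conj_ofReal]
    linear_combination (2 * (1 - s) : ℂ) * hb' + mul_inv_cancel₀ (mul_ne_zero two_ne_zero hneb)
  have huv : inner ℂ ((a : ℂ) • (ψ₁ + ψ₂)) ((b : ℂ) • (ψ₁ - ψ₂)) = (0 : ℂ) := by
    simp only [inner_smul_left, inner_smul_right, inner_add_left, inner_sub_right, h11, h22, hs,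
      hs']
    ring
  have horth : Orthonormal ℂ ![(a : ℂ) • (ψ₁ + ψ₂), (b : ℂ) • (ψ₁ - ψ₂)] := by
    rw [orthonormal_iff_ite]
    intro i j
    fin_cases i <;> fin_cases j
    · simpa using huu
    · simpa using huv
    · simpa using inner_eq_zero_symm.1 huv
    · simpa using hvv
  obtain ⟨E, hE⟩ := exists_operation_of_orthonormal horth (a := a) (b := b) hp
    (by rw [ha]; field_simp; linarith) (by rw [hb, ← div_eq_mul_inv, div_le_one hposb]; linarith)
    hρ₁ hρ₂ hC hCt
  refine ⟨E, (hE ψ₁).1 ?_ ?_, (hE ψ₂).2 ?_ ?_⟩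
  all_goals
    simp only [smul_smul, ha', hb', inner_smul_left, inner_add_left, inner_sub_left, h11, h22, hs,
      hs', map_inv₀, map_mul, map_add, map_sub, map_one, map_ofNat, Complex.conj_ofReal]
    field_simp
    ring

/-- A balanced operation with the optimal success probability, for states with real overlap `s`. -/
lemma exists_operation_optimalProb {ψ₁ ψ₂ : H} (hψ₁ : ‖ψ₁‖ = 1) (hψ₂ : ‖ψ₂‖ = 1) {s : ℝ}
    (hs : inner ℂ ψ₁ ψ₂ = (s : ℂ)) (hs0 : 0 ≤ s) {ρ₁ ρ₂ : K →L[ℂ] K}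
    (hρ₁ : IsDensity ρ₁) (hρ₂ : IsDensity ρ₂) :
    0 ≤ optimalProb ψ₁ ψ₂ ρ₁ ρ₂ ∧ ∃ E : QuantumOperation H K,
      (E.map (ketbra ψ₁) : K →L[ℂ] K) = (optimalProb ψ₁ ψ₂ ρ₁ ρ₂ : ℂ) • ρ₁ ∧
      (E.map (ketbra ψ₂) : K →L[ℂ] K) = (optimalProb ψ₁ ψ₂ ρ₁ ρ₂ : ℂ) • ρ₂ := by
  have hnorm : ‖inner ℂ ψ₁ ψ₂‖ = s := by rw [hs, Complex.norm_of_nonneg hs0]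
  have hs1 : s ≤ 1 := by
    have := norm_inner_le_norm (𝕜 := ℂ) ψ₁ ψ₂
    rwa [hnorm, hψ₁, hψ₂, one_mul] at this
  have hF0 := fidelity_nonneg ρ₁ ρ₂
  have hF1 := fidelity_le_one hρ₁ hρ₂
  rcases hs1.eq_or_lt with rfl | hs1
  · have hψ : ψ₁ = ψ₂ := (inner_eq_one_iff_of_norm_eq_one hψ₁ hψ₂).1 (by simpa using hs)
    subst hψ
    by_cases hF : fidelity ρ₁ ρ₂ = 1
    · obtain rfl := eq_of_fidelity_eq_one hρ₁ hρ₂ hF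
      obtain ⟨E, hE⟩ := exists_operation_of_eq hψ₁ hρ₁ zero_le_one le_rfl
      have hp : optimalProb ψ₁ ψ₁ ρ₁ ρ₁ = 1 := if_pos hF
      rw [hp]
      exact ⟨zero_le_one, E, hE, hE⟩
    · obtain ⟨E, hE⟩ := exists_operation_of_eq hψ₁ hρ₁ le_rfl zero_le_one
      have hp : optimalProb ψ₁ ψ₁ ρ₁ ρ₂ = 0 := by
        rw [optimalProb, if_neg hF, hnorm]; simp
      rw [hp]
      exact ⟨le_rfl, E, hE, by rw [hE]; simp⟩
  · -- The overlap of the purifications is `s` if the fidelity allows it, and the fidelity otherwise.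
    suffices h : 0 ≤ optimalProb ψ₁ ψ₂ ρ₁ ρ₂ ∧
        optimalProb ψ₁ ψ₂ ρ₁ ρ₂ * (1 + min s (fidelity ρ₁ ρ₂)) ≤ 1 + s ∧
        optimalProb ψ₁ ψ₂ ρ₁ ρ₂ * (1 - min s (fidelity ρ₁ ρ₂)) ≤ 1 - s from
      ⟨h.1, exists_operation_of_overlap hψ₁ hψ₂ hs hs0 hs1 hρ₁ hρ₂ h.1 (le_min hs0 hF0)
        (min_le_right _ _) h.2.1 h.2.2⟩
    rw [optimalProb, hnorm]
    split_ifs with hF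
    · rw [hF, min_eq_left hs1.le]
      exact ⟨zero_le_one, by simp, by simp⟩
    · have hF' : 0 < 1 - fidelity ρ₁ ρ₂ := sub_pos.2 (lt_of_le_of_ne hF1 hF)
      have hq : (1 - s) / (1 - fidelity ρ₁ ρ₂) * (1 - fidelity ρ₁ ρ₂) = 1 - s :=
        div_mul_cancel₀ _ hF'.ne'
      rcases le_total s (fidelity ρ₁ ρ₂) with h | h
      · rw [min_eq_left h, min_eq_right ((one_le_div hF').2 (by linarith))]
        exact ⟨zero_le_one, by simp, by simp⟩
      · rw [min_eq_right h, min_eq_left ((div_le_one hF').2 (by linarith))]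
        have h1 : (1 - s) / (1 - fidelity ρ₁ ρ₂) ≤ 1 := (div_le_one hF').2 (by linarith)
        exact ⟨div_nonneg (by linarith) hF'.le, by nlinarith, hq.le⟩

lemma optimalProb_bound {ψ₁ ψ₂ : H} (hψ₁ : ‖ψ₁‖ = 1) (hψ₂ : ‖ψ₂‖ = 1) {s : ℝ}
    (hs : inner ℂ ψ₁ ψ₂ = (s : ℂ)) (hs0 : 0 ≤ s) {ρ₁ ρ₂ : K →L[ℂ] K}
    (hρ₁ : IsDensity ρ₁) (hρ₂ : IsDensity ρ₂) (E : QuantumOperation H K) (h₁ : E.Sends ψ₁ ρ₁)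
    (h₂ : E.Sends ψ₂ ρ₂) :
    1 / 2 * E.prob ψ₁ + 1 / 2 * E.prob ψ₂ ≤ optimalProb ψ₁ ψ₂ ρ₁ ρ₂ := by
  have hp₁ := E.prob_le_one hψ₁
  have hp₂ := E.prob_le_one hψ₂
  have h := E.mean_prob_mul_le hψ₁ hψ₂ hs hρ₁ hρ₂ h₁ h₂
  rw [optimalProb, hs, Complex.norm_of_nonneg hs0]
  split_ifs with hF
  · linarith
  · have hF' : 0 < 1 - fidelity ρ₁ ρ₂ :=
      sub_pos.2 (lt_of_le_of_ne (fidelity_le_one hρ₁ hρ₂) hF)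
    refine le_min ((le_div_iff₀ hF').2 ?_) (by linarith)
    linarith

/-- A phase can be chosen that makes the overlap of two states real and nonnegative; it does not
change the state `|ψ⟩⟨ψ|`. -/
lemma exists_ketbra_eq_of_overlap (ψ₁ ψ₂ : H) :
    ∃ φ : H, ‖φ‖ = ‖ψ₂‖ ∧ ketbra φ = ketbra ψ₂ ∧ inner ℂ ψ₁ φ = (‖inner ℂ ψ₁ ψ₂‖ : ℂ) := by
  obtain ⟨c, hc, h⟩ := RCLike.exists_norm_eq_mul_self (inner ℂ ψ₁ ψ₂)
  refine ⟨c • ψ₂, by rw [norm_smul, hc, one_mul], ?_, by rw [inner_smul_right]; exact h.symm⟩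
  have hcc : c * starRingEnd ℂ c = 1 := by
    rw [Complex.mul_conj, Complex.normSq_eq_norm_sq, hc]; simp
  ext x
  simp only [ketbra, InnerProductSpace.rankOne_apply, inner_smul_left, smul_smul]
  rw [mul_right_comm, mul_comm _ c, hcc, one_mul]

end Quantum

end

theorem proposition2
    {H : Type*} [NormedAddCommGroup H] [InnerProductSpace ℂ H] [CompleteSpace H]
    {K : Type*} [NormedAddCommGroup K] [InnerProductSpace ℂ K] [CompleteSpace K]
    (ψ₁ ψ₂ : H) (hψ₁ : ‖ψ₁‖ = 1) (hψ₂ : ‖ψ₂‖ = 1)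
    (ρ₁ ρ₂ : K →L[ℂ] K) (hρ₁ : Quantum.IsDensity ρ₁) (hρ₂ : Quantum.IsDensity ρ₂) :
    IsGreatest
      {p : ℝ | ∃ E : Quantum.QuantumOperation H K,
        E.Sends ψ₁ ρ₁ ∧ E.Sends ψ₂ ρ₂ ∧ p = 1 / 2 * E.prob ψ₁ + 1 / 2 * E.prob ψ₂}
      (Quantum.optimalProb ψ₁ ψ₂ ρ₁ ρ₂) ∧
    ∃ E : Quantum.QuantumOperation H K,
      E.Sends ψ₁ ρ₁ ∧ E.Sends ψ₂ ρ₂ ∧ E.prob ψ₁ = E.prob ψ₂ ∧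
      1 / 2 * E.prob ψ₁ + 1 / 2 * E.prob ψ₂ = Quantum.optimalProb ψ₁ ψ₂ ρ₁ ρ₂ := by
  obtain ⟨φ, hφ, hket, hinner⟩ := Quantum.exists_ketbra_eq_of_overlap ψ₁ ψ₂
  rw [hψ₂] at hφ
  have hopt : Quantum.optimalProb ψ₁ φ ρ₁ ρ₂ = Quantum.optimalProb ψ₁ ψ₂ ρ₁ ρ₂ := by
    simp only [Quantum.optimalProb, hinner, Complex.norm_real, norm_norm]
  obtain ⟨hp, E, hE₁, hE₂⟩ := Quantum.exists_operation_optimalProb hψ₁ hφ hinner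
    (norm_nonneg _) hρ₁ hρ₂
  rw [hopt] at hp hE₁ hE₂
  rw [hket] at hE₂
  have hp₁ := Quantum.QuantumOperation.prob_eq_of_map_eq hρ₁ hp hE₁
  have hp₂ := Quantum.QuantumOperation.prob_eq_of_map_eq hρ₂ hp hE₂
  have hS₁ : E.Sends ψ₁ ρ₁ := by rw [Quantum.QuantumOperation.Sends, hp₁, hE₁]
  have hS₂ : E.Sends ψ₂ ρ₂ := by rw [Quantum.QuantumOperation.Sends, hp₂, hE₂]
  have hmean : 1 / 2 * E.prob ψ₁ + 1 / 2 * E.prob ψ₂ = Quantum.optimalProb ψ₁ ψ₂ ρ₁ ρ₂ := by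
    rw [hp₁, hp₂]; ring
  refine ⟨⟨⟨E, hS₁, hS₂, hmean.symm⟩, ?_⟩, E, hS₁, hS₂, hp₁.trans hp₂.symm, hmean⟩
  rintro _ ⟨E', h₁, h₂, rfl⟩
  have hprob : E'.prob φ = E'.prob ψ₂ := by
    rw [Quantum.QuantumOperation.prob, hket, Quantum.QuantumOperation.prob]
  have h₂' : E'.Sends φ ρ₂ := by
    rw [Quantum.QuantumOperation.Sends, hprob, hket]; exact h₂
  have h := Quantum.optimalProb_bound hψ₁ hφ hinner (norm_nonneg _) hρ₁ hρ₂ E' h₁ h₂'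
  rwa [hprob, hopt] at h
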